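/- Let $k$ be an algebraically closed field (of any characteristic). For a group $\Gamma$, the character of a representation $\rho:\Gamma\to \mathrm{SL}_2(k)$ is $\chi_\rho:\Gamma\to k$, $\chi_\rho(\gamma)=\operatorname{tr}\rho(\gamma)$, and the character variety is the set of characters $$\mathfrak X(\Gamma,\mathrm{SL}_2)=\{\chi_\rho \mid \rho\in \mathrm{Hom}(\Gamma,\mathrm{SL}_2(k))\}\subset k^\Gamma ,$$ whose ring of regular functions is the $k$-algebra of functions generated by the traces $\chi\mapsto\chi(\gamma)$, $\gamma\in\Gamma$. Let $F_2$ be the free group on $x_1,x_2$. Then $\mathfrak X(F_2,\mathrm{SL}_2)$ is isomorphic, as an algebraic variety, to the affine space $k^3$, with coordinates $(t_A,t_B,t_{AB})$: there is a bijection $\varphi:\mathfrak X(F_2,\mathrm{SL}_2)\to k^3$ such that $\varphi$ and $\varphi^{-1}$ are both regular (they pull regular functions back to regular functions), and such that for all $A,B\in \mathrm{SL}_2(k)$, if $\rho:F_2\to\mathrm{SL}_2(k)$ is the representation with $\rho(x_1)=A$, $\rho(x_2)=B$, then $$\varphi(\chi_\rho)=(\operatorname{tr}A,\ \operatorname{tr}B,\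 \operatorname{tr}(AB)).$$ -/

import Mathlib

namespace CharVar

/-- The ring of regular functions on a subset `S` of the affine space `k^ι`: the restrictions to
`S` of polynomials in finitely many of the coordinates. -/
def regularFunctions {k ι : Type*} [Field k] (S : Set (ι → k)) : Subalgebra k (S → k) :=
  Algebra.adjoin k (Set.range fun (i : ι) (x : S) => (x : ι → k) i)

/-- A map between subsets of affine spaces is regular if it pulls regular functions back to regular
functions (equivalently, if it is given by polynomials in the coordinates). -/
def IsRegularMap {k ι κ : Type*} [Field k] (S : Set (ι → k)) (T : Set (κ → k)) (φ : S → T) :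
    Prop :=
  ∀ f ∈ regularFunctions T, f ∘ φ ∈ regularFunctions S

/-- An isomorphism of algebraic sets: a regular bijection whose inverse is regular. -/
structure RegularIso {k ι κ : Type*} [Field k] (S : Set (ι → k)) (T : Set (κ → k))
    extends S ≃ T where
  regular : IsRegularMap S T toFun
  regular_symm : IsRegularMap T S invFun

/-- The space `R(Γ, SL_r) = Hom(Γ, SL_r)` of representations over `k`. -/
abbrev Rep (k Γ : Type*) [Field k] [Group Γ] (r : ℕ) : Type _ :=
  Γ →* Matrix.SpecialLinearGroup (Fin r) k

/-- The character `γ ↦ tr ρ(γ)` of a representation `ρ`. -/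
def character {k Γ : Type*} [Field k] [Group Γ] {r : ℕ} (ρ : Rep k Γ r) : Γ → k :=
  fun γ => (ρ γ : Matrix (Fin r) (Fin r) k).trace

/-- The character variety `𝔛(Γ, SL_r)`: the image of `ρ ↦ χ_ρ` in `k^Γ`. As a subset of the affine
space `k^Γ` it carries the ring `regularFunctions` generated by the traces `χ ↦ χ(γ)`, `γ ∈ Γ`. -/
def characterVariety (k Γ : Type*) [Field k] [Group Γ] (r : ℕ) : Set (Γ → k) :=
  Set.range (character : Rep k Γ r → Γ → k)

/-- The point `χ_ρ` of the character variety. -/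
def characterPoint {k Γ : Type*} [Field k] [Group Γ] {r : ℕ} (ρ : Rep k Γ r) :
    characterVariety k Γ r :=
  ⟨character ρ, ρ, rfl⟩

/-- The affine space `k^n` as an algebraic set. -/
abbrev affineSpace (k : Type*) [Field k] (n : ℕ) : Set (Fin n → k) :=
  Set.univ

end CharVar

namespace CharVar

open MvPolynomial Matrix

/-! By Cayley–Hamilton and its polarization, the combinations of `1`, `A`, `B`, `A * B` with
coefficients polynomial in the three traces are stable under left multiplication by `A`, `B` and
their inverses. So every word in `A`, `B` is such a combination, and its trace is a polynomial in
the three traces (`exists_trace_lift_eq_eval`). This gives both the injectivity of `frickeMap` and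
the regularity of its inverse. Surjectivity is an explicit pair of matrices
(`exists_traceCoords_eq`). -/

/-- The traces of two matrices and of their product. -/
def traceCoords {k : Type*} [Field k] (A B : Matrix (Fin 2) (Fin 2) k) : Fin 3 → k :=
  ![A.trace, B.trace, (A * B).trace]

/-- The combination of `1`, `A`, `B`, `A * B` whose coefficients are given polynomials in the
traces of `A`, `B` and `A * B`. -/
noncomputable def traceComb {k : Type*} [Field k] (p : Fin 4 → MvPolynomial (Fin 3) k)
    (A B : Matrix (Fin 2) (Fin 2) k) : Matrix (Fin 2) (Fin 2) k :=
  eval (traceCoords A B) (p 0) • 1 + eval (traceCoords A B) (p 1) • A +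
    eval (traceCoords A B) (p 2) • B + eval (traceCoords A B) (p 3) • (A * B)

section Identities

variable {k : Type*} [Field k]

theorem mul_self_eq_of_det_eq_one (A : Matrix (Fin 2) (Fin 2) k) (hA : A.det = 1) :
    A * A = A.trace • A - 1 := by
  rw [det_fin_two] at hA
  ext i j
  fin_cases i <;> fin_cases j <;> simp [mul_apply, Fin.sum_univ_two, trace_fin_two]
  · linear_combination -hA
  · ring
  · ring
  · linear_combination -hA

/-- Polarized Cayley–Hamilton: it moves `A` to the left of `B`. -/
theorem mul_comm_eq_fin_two (A B : Matrix (Fin 2) (Fin 2) k) :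
    B * A = -(A * B) + A.trace • B + B.trace • A +
      ((A * B).trace - A.trace * B.trace) • (1 : Matrix (Fin 2) (Fin 2) k) := by
  ext i j
  fin_cases i <;> fin_cases j <;> simp [mul_apply, Fin.sum_univ_two, trace_fin_two] <;> ring

theorem mul_mul_self_eq_of_det_eq_one (A B : Matrix (Fin 2) (Fin 2) k) (hB : B.det = 1) :
    B * (A * B) = A - A.trace • (1 : Matrix (Fin 2) (Fin 2) k) + (A * B).trace • B := by
  rw [← mul_assoc, mul_comm_eq_fin_two A B]
  simp only [add_mul, neg_mul, smul_mul_assoc, mul_assoc, mul_self_eq_of_det_eq_one B hB,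
    mul_sub, mul_smul_comm, mul_one, one_mul]
  module

theorem coe_inv_eq_trace_smul_sub (A : SpecialLinearGroup (Fin 2) k) :
    ((A⁻¹ : SpecialLinearGroup (Fin 2) k) : Matrix (Fin 2) (Fin 2) k) =
      (A : Matrix (Fin 2) (Fin 2) k).trace • (1 : Matrix (Fin 2) (Fin 2) k) - A := by
  refine (Matrix.SpecialLinearGroup.coe_inv A).trans ?_
  rw [adjugate_fin_two]
  ext i j
  fin_cases i <;> fin_cases j <;> simp [trace_fin_two]

theorem left_mul_traceComb (p : Fin 4 → MvPolynomial (Fin 3) k)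
    (A B : Matrix (Fin 2) (Fin 2) k) (hA : A.det = 1) :
    A * traceComb p A B =
      traceComb ![-p 1, p 0 + X 0 * p 1, -p 3, p 2 + X 0 * p 3] A B := by
  have h : A * (A * B) = A.trace • (A * B) - B := by
    rw [← mul_assoc, mul_self_eq_of_det_eq_one A hA, sub_mul, smul_mul_assoc, one_mul]
  have hx : traceCoords A B 0 = A.trace := rfl
  simp only [traceComb, mul_add, mul_smul_comm, mul_one, h, mul_self_eq_of_det_eq_one A hA,
    cons_val, map_add, map_mul, map_neg, eval_X, hx]
  module

theorem right_mul_traceComb (p : Fin 4 → MvPolynomial (Fin 3) k)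
    (A B : Matrix (Fin 2) (Fin 2) k) (hB : B.det = 1) :
    B * traceComb p A B =
      traceComb ![p 1 * (X 2 - X 0 * X 1) - p 2 - X 0 * p 3, X 1 * p 1 + p 3,
        p 0 + X 0 * p 1 + X 1 * p 2 + X 2 * p 3, -p 1] A B := by
  have hx : traceCoords A B 0 = A.trace := rfl
  have hy : traceCoords A B 1 = B.trace := rfl
  have hz : traceCoords A B 2 = (A * B).trace := rfl
  simp only [traceComb, mul_add, mul_smul_comm, mul_one, mul_comm_eq_fin_two A B,
    mul_mul_self_eq_of_det_eq_one A B hB, mul_self_eq_of_det_eq_one B hB,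
    cons_val, map_add, map_mul, map_neg, map_sub, eval_X, hx, hy, hz]
  module

theorem smul_sub_traceComb (f : MvPolynomial (Fin 3) k) (p q : Fin 4 → MvPolynomial (Fin 3) k)
    (A B : Matrix (Fin 2) (Fin 2) k) :
    eval (traceCoords A B) f • traceComb q A B - traceComb p A B =
      traceComb (fun i => f * q i - p i) A B := by
  simp only [traceComb, map_sub, map_mul]
  module

/-- Multiplication by a word in two matrices of determinant one preserves the combinations of
`1`, `A`, `B`, `A * B` with coefficients polynomial in the traces. -/
theorem exists_lift_mul_traceComb (w : FreeGroup (Fin 2)) :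
    ∀ q : Fin 4 → MvPolynomial (Fin 3) k, ∃ p : Fin 4 → MvPolynomial (Fin 3) k,
      ∀ A B : SpecialLinearGroup (Fin 2) k,
        (FreeGroup.lift ![A, B] w : Matrix (Fin 2) (Fin 2) k) * traceComb q A B =
          traceComb p A B := by
  induction w using FreeGroup.induction_on with
  | C1 => exact fun q => ⟨q, fun A B => by simp⟩
  | of i =>
    intro q
    fin_cases i
    · exact ⟨_, fun A B => by simpa using left_mul_traceComb q A B A.det_coe⟩
    · exact ⟨_, fun A B => by simpa using right_mul_traceComb q A B B.det_coe⟩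
  | inv_of i ih =>
    intro q
    obtain ⟨p, hp⟩ := ih q
    -- In determinant one, the inverse of a generator is its trace minus itself; the traces of the
    -- two generators are coordinates 0 and 1 of the three.
    refine ⟨fun j => X (Fin.castLE (by norm_num) i) * q j - p j, fun A B => ?_⟩
    rw [map_inv, coe_inv_eq_trace_smul_sub, sub_mul, smul_mul_assoc, one_mul, hp,
      ← smul_sub_traceComb, eval_X]
    congr 2
    fin_cases i <;> simp [traceCoords]
  | mul v w hv hw =>
    intro q
    obtain ⟨p, hp⟩ := hw q
    obtain ⟨r, hr⟩ := hv p
    exact ⟨r, fun A B => by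
      rw [map_mul, ← hr, ← hp, ← mul_assoc]
      exact congrArg (· * _) (Matrix.SpecialLinearGroup.coe_mul _ _)⟩

/-- **Fricke–Vogt**: the trace of a word in two matrices of determinant one is a polynomial in the
traces of the two matrices and of their product. -/
theorem exists_trace_lift_eq_eval (w : FreeGroup (Fin 2)) :
    ∃ P : MvPolynomial (Fin 3) k, ∀ A B : SpecialLinearGroup (Fin 2) k,
      (FreeGroup.lift ![A, B] w : Matrix (Fin 2) (Fin 2) k).trace =
        eval (traceCoords (A : Matrix (Fin 2) (Fin 2) k) B) P := by
  -- Applied to the identity matrix, the word itself becomes a combination; the 2 below is the trace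
  -- of `1`.
  obtain ⟨p, hp⟩ := exists_lift_mul_traceComb (k := k) w ![1, 0, 0, 0]
  refine ⟨2 * p 0 + X 0 * p 1 + X 1 * p 2 + X 2 * p 3, fun A B => ?_⟩
  have h : traceComb ![1, 0, 0, 0] (A : Matrix (Fin 2) (Fin 2) k) B = 1 := by
    simp [traceComb]
  have hx : traceCoords (A : Matrix (Fin 2) (Fin 2) k) B 0 = trace A.1 := rfl
  have hy : traceCoords (A : Matrix (Fin 2) (Fin 2) k) B 1 = trace B.1 := rfl
  have hz : traceCoords (A : Matrix (Fin 2) (Fin 2) k) B 2 = trace (A.1 * B.1) := rfl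
  have h' := hp A B
  rw [h, mul_one] at h'
  rw [h']
  simp only [traceComb, trace_add, trace_smul, trace_one, Fintype.card_fin, smul_eq_mul,
    map_add, map_mul, map_ofNat, eval_X, hx, hy, hz]
  push_cast
  ring

theorem exists_traceCoords_eq [IsAlgClosed k] (v : Fin 3 → k) :
    ∃ A B : SpecialLinearGroup (Fin 2) k, traceCoords (A : Matrix (Fin 2) (Fin 2) k) B = v := by
  -- For the matrices chosen below, `A * B` has diagonal entries `s⁻¹` and `s`, so `s + s⁻¹ = v 2`
  -- is required.
  obtain ⟨s, hs⟩ : ∃ s : k, 1 * (s * s) + -v 2 * s + 1 = 0 := by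
    have hd : (Polynomial.X ^ 2 - Polynomial.C (v 2) * Polynomial.X + 1 :
        Polynomial k).degree = 2 := by
      compute_degree!
    obtain ⟨s, hs⟩ := IsAlgClosed.exists_root _ (by rw [hd]; norm_num)
    refine ⟨s, ?_⟩
    simp [Polynomial.IsRoot] at hs
    linear_combination hs
  have hs0 : s ≠ 0 := by
    rintro rfl
    simp at hs
  refine ⟨⟨!![v 0, -1; 1, 0], by simp [det_fin_two]⟩,
    ⟨!![0, s; -s⁻¹, v 1], by simp [det_fin_two, hs0]⟩, ?_⟩
  ext i
  fin_cases i
  · simp [traceCoords, trace_fin_two]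
  · simp [traceCoords, trace_fin_two]
  · simp [traceCoords, trace_fin_two]
    field_simp
    linear_combination hs

end Identities

section Regular

variable {k : Type*} [Field k]

/-- Pullback is an algebra homomorphism, so generators suffice. -/
theorem isRegularMap_of_coord {ι κ : Type*} {S : Set (ι → k)} {T : Set (κ → k)} {φ : S → T}
    (h : ∀ j, (fun x => (φ x : κ → k) j) ∈ regularFunctions S) : IsRegularMap S T φ := by
  intro f hf
  induction hf using Algebra.adjoin_induction with
  | mem f hf =>
    obtain ⟨j, rfl⟩ := hf
    exact h j
  | algebraMap r => exact (regularFunctions S).algebraMap_mem r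
  | add f g _ _ hf hg => exact (regularFunctions S).add_mem hf hg
  | mul f g _ _ hf hg => exact (regularFunctions S).mul_mem hf hg

theorem coord_mem_regularFunctions {ι : Type*} (S : Set (ι → k)) (i : ι) :
    (fun x : S => (x : ι → k) i) ∈ regularFunctions S :=
  Algebra.subset_adjoin ⟨i, rfl⟩

theorem eval_mem_regularFunctions {ι : Type*} (S : Set (ι → k)) (P : MvPolynomial ι k) :
    (fun x : S => eval (x : ι → k) P) ∈ regularFunctions S := by
  induction P using MvPolynomial.induction_on with
  | C a =>
    simp only [eval_C]
    exact (regularFunctions S).algebraMap_mem a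
  | add p q hp hq =>
    simp only [map_add]
    exact (regularFunctions S).add_mem hp hq
  | mul_X p i hp =>
    simp only [map_mul, eval_X]
    exact (regularFunctions S).mul_mem hp (coord_mem_regularFunctions S i)

end Regular

/-- The coordinates `(t_A, t_B, t_{AB})` on the character variety of the free group of rank two. -/
def frickeMap (k : Type*) [Field k] (χ : characterVariety k (FreeGroup (Fin 2)) 2) :
    affineSpace k 3 :=
  ⟨![χ.1 (FreeGroup.of 0), χ.1 (FreeGroup.of 1), χ.1 (FreeGroup.of 0 * FreeGroup.of 1)],
    Set.mem_univ _⟩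

section Fricke

variable {k : Type*} [Field k]

theorem frickeMap_characterPoint_lift (A B : SpecialLinearGroup (Fin 2) k) :
    (frickeMap k (characterPoint (FreeGroup.lift ![A, B])) : Fin 3 → k) =
      traceCoords (A : Matrix (Fin 2) (Fin 2) k) B := by
  simp [frickeMap, characterPoint, character, traceCoords]

theorem exists_characterPoint_lift_eq (χ : characterVariety k (FreeGroup (Fin 2)) 2) :
    ∃ A B : SpecialLinearGroup (Fin 2) k, characterPoint (FreeGroup.lift ![A, B]) = χ := by
  obtain ⟨_, ρ, rfl⟩ := χ
  refine ⟨ρ (FreeGroup.of 0), ρ (FreeGroup.of 1), ?_⟩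
  have h : FreeGroup.lift ![ρ (FreeGroup.of 0), ρ (FreeGroup.of 1)] = ρ := by
    ext1 i
    fin_cases i <;> simp
  rw [h]
  rfl

theorem exists_apply_eq_eval_frickeMap (w : FreeGroup (Fin 2)) :
    ∃ P : MvPolynomial (Fin 3) k, ∀ χ : characterVariety k (FreeGroup (Fin 2)) 2,
      χ.1 w = eval (frickeMap k χ : Fin 3 → k) P := by
  obtain ⟨P, hP⟩ := exists_trace_lift_eq_eval (k := k) w
  refine ⟨P, fun χ => ?_⟩
  obtain ⟨A, B, rfl⟩ := exists_characterPoint_lift_eq χ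
  rw [frickeMap_characterPoint_lift]
  exact hP A B

theorem frickeMap_bijective [IsAlgClosed k] : Function.Bijective (frickeMap k) := by
  constructor
  · intro χ ψ h
    ext w
    obtain ⟨P, hP⟩ := exists_apply_eq_eval_frickeMap (k := k) w
    rw [hP, hP, h]
  · rintro ⟨v, hv⟩
    obtain ⟨A, B, h⟩ := exists_traceCoords_eq v
    exact ⟨characterPoint (FreeGroup.lift ![A, B]),
      Subtype.ext ((frickeMap_characterPoint_lift A B).trans h)⟩

theorem isRegularMap_frickeMap : IsRegularMap _ _ (frickeMap k) := by
  refine isRegularMap_of_coord fun j => ?_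
  fin_cases j <;> exact coord_mem_regularFunctions _ _

theorem isRegularMap_of_rightInverse_frickeMap
    {ψ : affineSpace k 3 → characterVariety k (FreeGroup (Fin 2)) 2}
    (hψ : Function.RightInverse ψ (frickeMap k)) : IsRegularMap _ _ ψ := by
  refine isRegularMap_of_coord fun w => ?_
  obtain ⟨P, hP⟩ := exists_apply_eq_eval_frickeMap (k := k) w
  -- The coordinate `w` of `ψ v` is `P` evaluated at `frickeMap k (ψ v) = v`.
  simp only [hP, hψ _]
  exact eval_mem_regularFunctions _ P

end Fricke

end CharVar

theorem mainTheorem8 (k : Type*) [Field k] [IsAlgClosed k] :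
    ∃ φ : CharVar.RegularIso
        (CharVar.characterVariety k (FreeGroup (Fin 2)) 2) (CharVar.affineSpace k 3),
      ∀ A B : Matrix.SpecialLinearGroup (Fin 2) k,
        (φ.toEquiv (CharVar.characterPoint (FreeGroup.lift ![A, B])) : Fin 3 → k) =
          ![(A : Matrix (Fin 2) (Fin 2) k).trace,
            (B : Matrix (Fin 2) (Fin 2) k).trace,
            ((A * B : Matrix.SpecialLinearGroup (Fin 2) k) :
              Matrix (Fin 2) (Fin 2) k).trace] := by
  let e := Equiv.ofBijective (CharVar.frickeMap k) CharVar.frickeMap_bijective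
  exact ⟨⟨e, CharVar.isRegularMap_frickeMap,
    CharVar.isRegularMap_of_rightInverse_frickeMap e.right_inv⟩,
    CharVar.frickeMap_characterPoint_lift⟩
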